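/- Let $\mathbb T^2=\{z\in\mathbb C:|z|=1\}^2$. Call a topological group automorphism $\sigma$ of $\mathbb T^2$ hyperbolic if the integer $2\times 2$ matrix inducing it has no complex eigenvalue of modulus one; such automorphisms exist. Let $\sigma$ be any hyperbolic automorphism of $\mathbb T^2$, let $G=\mathbb T^2\rtimes\mathbb Z$ be the topological semidirect product in which $\mathbb Z$ acts on $\mathbb T^2$ by the iterates of $\sigma$, and let $H=\{e\}\times\mathbb Z\le G$. Then $G$ is a two-dimensional Lie group, $H$ is a discrete subgroup, the coset space $G/H$ (with the quotient topology) is a compact two-dimensional manifold on which $G$ acts continuously by left translations, and the $G$-space $G/H$ is not Rosenthal representable: there is no real Banach space $V$ containing no isomorphic copy of $\ell_1$ for which there exist a homomorphism $h\colon G\to \mathrm{Iso}(V)$ into the group of linear isometries of $V$, continuous in the strong operator topology, and a bounded map $\alpha\colon G/H\to V^*$ that is a topological embedding for the weak-star topology and satisfies $\alpha(gx)(v)=\alpha(x)(h(g)^{-1}v)$ for all $g\in G$, $x\in G/H$, $v\in V$. -/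

import Mathlib

open scoped Manifold ContDiff

universe u

/-- A real Banach space is a *Rosenthal space* if it does not contain an isomorphic copy of `ℓ¹`,
i.e. there is no bounded linear map `ℓ¹ → V` that is bounded below. -/
def IsRosenthalSpace (V : Type*) [NormedAddCommGroup V] [NormedSpace ℝ V] : Prop :=
  ¬ ∃ T : lp (fun _ : ℕ => ℝ) 1 →L[ℝ] V, ∃ c : ℝ, 0 < c ∧ ∀ x, c * ‖x‖ ≤ ‖T x‖

/-- A representation of a `G`-space `X` on a Banach space `V`: a homomorphism
`h : G → Iso(V)` into the group of linear isometries of `V`, continuous for the strong operator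
topology (the topology of pointwise convergence on `V`), together with a bounded, weak-star
continuous map `α : X → V*` which is equivariant for the dual action
`(g φ)(v) = φ (g⁻¹ v)`. -/
structure BanachRepresentation (G X V : Type*) [Group G] [TopologicalSpace G]
    [TopologicalSpace X] [MulAction G X] [NormedAddCommGroup V] [NormedSpace ℝ V] where
  h : G →* (V ≃ₗᵢ[ℝ] V)
  continuous_h : ∀ v : V, Continuous fun g : G => h g v
  α : X → WeakDual ℝ V
  continuous_α : Continuous α
  bounded_α : ∃ C : ℝ, ∀ x : X, ‖WeakDual.toStrongDual (α x)‖ ≤ C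
  equivariant_α : ∀ (g : G) (x : X) (v : V), α (g • x) v = α x ((h g)⁻¹ v)

/-- The `G`-space `X` is *Rosenthal representable* if it has a proper representation on some
Rosenthal Banach space, proper meaning that `α : X → (V*, weak-star)` is a topological
embedding. -/
def IsRosenthalRepresentable.{w, v₁, v₂} (G : Type v₁) (X : Type v₂) [Group G]
    [TopologicalSpace G] [TopologicalSpace X] [MulAction G X] : Prop :=
  ∃ (V : Type w) (_ : NormedAddCommGroup V) (_ : NormedSpace ℝ V) (_ : CompleteSpace V),
    IsRosenthalSpace V ∧
      ∃ ρ : BanachRepresentation G X V, Topology.IsEmbedding ρ.α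

/-- The two-dimensional torus `𝕋²`, written multiplicatively. -/
abbrev Torus2 : Type := Fin 2 → Circle

/-- A topological group automorphism of `𝕋²` is *hyperbolic* if the integer matrix that induces
it has no complex eigenvalue of modulus one. -/
def IsHyperbolicAut (σ : Torus2 ≃ₜ* Torus2) : Prop :=
  ∃ A : Matrix (Fin 2) (Fin 2) ℤ,
    (∀ (z : Torus2) (i : Fin 2), σ z i = ∏ j, z j ^ A i j) ∧
    ∀ μ : ℂ, Module.End.HasEigenvalue (Matrix.toLin' (A.map (Int.cast : ℤ → ℂ))) μ → ‖μ‖ ≠ 1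

/-- The action of `ℤ` on `𝕋²` by the iterates of `σ`. -/
noncomputable def iterateHom (σ : Torus2 ≃ₜ* Torus2) : Multiplicative ℤ →* MulAut Torus2 :=
  zpowersHom (MulAut Torus2) σ.toMulEquiv

/-- The group `𝕋² ⋊ ℤ`, with `ℤ` acting by the iterates of `σ`. -/
abbrev ToralGroup (σ : Torus2 ≃ₜ* Torus2) : Type :=
  Torus2 ⋊[iterateHom σ] Multiplicative ℤ

/-- The topology of a topological semidirect product is the product topology. -/
instance SemidirectProduct.instTopologicalSpaceProd {N K : Type*} [Group N] [Group K]
    [TopologicalSpace N] [TopologicalSpace K] (φ : K →* MulAut N) :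
    TopologicalSpace (N ⋊[φ] K) :=
  TopologicalSpace.induced (fun p => (p.left, p.right)) inferInstance

/-- The canonical copy `{e} × ℤ` of `ℤ` in `𝕋² ⋊ ℤ`. -/
noncomputable def ToralGroup.intSubgroup (σ : Torus2 ≃ₜ* Torus2) : Subgroup (ToralGroup σ) :=
  (SemidirectProduct.inr : Multiplicative ℤ →* ToralGroup σ).range

/-- The topological group `G` carries the structure of a real Lie group of dimension `n`,
compatible with its given topology. -/
def IsLieGroupOfDim (n : ℕ) (G : Type*) [Group G] [TopologicalSpace G] : Prop :=
  T2Space G ∧ SecondCountableTopology G ∧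
    ∃ (E : Type) (_ : NormedAddCommGroup E) (_ : NormedSpace ℝ E) (H : Type)
      (_ : TopologicalSpace H) (I : ModelWithCorners ℝ E H) (_ : ChartedSpace H G),
      I.Boundaryless ∧ FiniteDimensional ℝ E ∧ Module.finrank ℝ E = n ∧ LieGroup I ∞ G

/-- `X` is a topological manifold (without boundary) of dimension `n`. -/
def IsTopologicalManifoldOfDim (n : ℕ) (X : Type*) [TopologicalSpace X] : Prop :=
  T2Space X ∧ SecondCountableTopology X ∧ Nonempty (ChartedSpace (EuclideanSpace ℝ (Fin n)) X)

/-! The left component identifies `G/H` with the torus, and `inr n` then acts as `σ^n`. So it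
suffices that a nonconstant, bounded, weak-star continuous equivariant family of functionals over a
mixing system forces `ℓ¹` into the Banach space (`not_isRosenthalSpace_of_mixing`).

Mixing is checked on characters. The integral of `(χ ∘ σ^n) * ψ` vanishes unless `χ ∘ σ^n = ψ⁻¹`. If
that held for infinitely many `n` with `χ` nontrivial, some nonzero integer row vector would be
fixed by a positive power of the matrix, which would then have a root of unity as an eigenvalue.
Stone–Weierstrass extends the decay to all continuous functions.

Mixing gives times `n i` at which the sets where a vector `v` takes small and large values are
independent. By Rosenthal's sign argument, the vectors `h(n i)⁻¹ v` then satisfy a lower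
`ℓ¹`-estimate.

For the Lie group structure, every iterate of `σ` is a monomial map whose exponents depend only on
the discrete coordinate. -/

/-! ### Characters and mixing on compact abelian groups. -/

section Mixing

open MeasureTheory Filter Topology

/-- A continuous character as a complex-valued continuous function. -/
noncomputable def ContinuousMonoidHom.toComplexMap {K : Type*} [CommGroup K] [TopologicalSpace K]
    (χ : K →ₜ* Circle) : C(K, ℂ) :=
  ⟨fun x => (χ x : ℂ), by fun_prop⟩

variable {K : Type*} [CommGroup K] [TopologicalSpace K] [IsTopologicalGroup K] [CompactSpace K]

theorem ContinuousMonoidHom.circle_inv_apply {K : Type*} [CommGroup K] [TopologicalSpace K]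
    (χ : K →ₜ* Circle) (x : K) : χ⁻¹ x = (χ x)⁻¹ := rfl

/-- If a subgroup of characters separates the points of `K`, then its linear span is dense. -/
theorem span_characters_dense (D : Subgroup (K →ₜ* Circle))
    (hD : ∀ x y : K, x ≠ y → ∃ χ ∈ D, χ x ≠ χ y) :
    (Submodule.span ℂ (ContinuousMonoidHom.toComplexMap '' (D : Set (K →ₜ* Circle)))).topologicalClosure
      = ⊤ := by
  set S : Set C(K, ℂ) := ContinuousMonoidHom.toComplexMap '' (D : Set (K →ₜ* Circle)) with hS
  let A : StarSubalgebra ℂ C(K, ℂ) :=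
    { toSubalgebra := Algebra.adjoin ℂ S
      star_mem' := by
        change Algebra.adjoin ℂ S ≤ star (Algebra.adjoin ℂ S)
        refine Algebra.adjoin_le ?_
        rintro _ ⟨χ, hχ, rfl⟩
        refine Algebra.subset_adjoin ⟨χ⁻¹, D.inv_mem hχ, ?_⟩
        ext x
        simp [ContinuousMonoidHom.toComplexMap, ← Circle.coe_inv_eq_conj,
          ContinuousMonoidHom.circle_inv_apply] }
  -- Products of characters in `D` stay in `D`, so the generated algebra is only the linear span.
  have hA : A.toSubalgebra.toSubmodule = Submodule.span ℂ S := by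
    apply Algebra.adjoin_eq_span_of_subset
    refine .trans (fun x ↦ Submonoid.closure_induction (fun _ ↦ id) ⟨1, D.one_mem, ?_⟩ ?_)
      Submodule.subset_span
    · ext z
      simp [ContinuousMonoidHom.toComplexMap]
    · rintro _ _ _ _ ⟨m, hm, rfl⟩ ⟨n, hn, rfl⟩
      refine ⟨m * n, D.mul_mem hm hn, ?_⟩
      ext z
      simp [ContinuousMonoidHom.toComplexMap]
  have hsep : A.SeparatesPoints := by
    intro x y hxy
    obtain ⟨χ, hχ, hne⟩ := hD x y hxy
    refine ⟨_, ⟨χ.toComplexMap, Algebra.subset_adjoin ⟨χ, hχ, rfl⟩, rfl⟩, ?_⟩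
    simpa [ContinuousMonoidHom.toComplexMap, Circle.coe_inj] using hne
  rw [← hA]
  exact congr_arg (Subalgebra.toSubmodule <| StarSubalgebra.toSubalgebra ·)
    (ContinuousMap.starSubalgebra_topologicalClosure_eq_top_of_separatesPoints A hsep)

/-- A uniformly bounded sequence of linear functionals that tends to zero pointwise on a set with
dense span tends to zero pointwise. -/
theorem tendsto_zero_of_span_dense {E : Type*} [NormedAddCommGroup E] [NormedSpace ℂ E]
    (L : ℕ → E →ₗ[ℂ] ℂ) (C : ℝ) (hC : ∀ n x, ‖L n x‖ ≤ C * ‖x‖) (S : Set E)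
    (hS : (Submodule.span ℂ S).topologicalClosure = ⊤)
    (h : ∀ x ∈ S, Tendsto (fun n => L n x) atTop (𝓝 0)) (x : E) :
    Tendsto (fun n => L n x) atTop (𝓝 0) := by
  have hspan : ∀ y ∈ Submodule.span ℂ S, Tendsto (fun n => L n y) atTop (𝓝 0) := by
    intro y hy
    induction hy using Submodule.span_induction with
    | mem y hy => exact h y hy
    | zero => simp
    | add y z _ _ hy hz => simpa using hy.add hz
    | smul c y _ hy => simpa using hy.const_mul c
  -- A strictly positive bound, so that `ε` can be divided by it.
  have hC' : ∀ n x, ‖L n x‖ ≤ (|C| + 1) * ‖x‖ := fun n x =>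
    (hC n x).trans (mul_le_mul_of_nonneg_right (by linarith [le_abs_self C]) (norm_nonneg _))
  rw [Metric.tendsto_atTop]
  intro ε hε
  have hx : x ∈ closure (Submodule.span ℂ S : Set E) := by
    rw [← Submodule.topologicalClosure_coe, hS]; trivial
  have hpos : 0 < |C| + 1 := by positivity
  obtain ⟨y, hy, hxy⟩ := Metric.mem_closure_iff.1 hx (ε / 2 / (|C| + 1)) (by positivity)
  obtain ⟨N, hN⟩ := Metric.tendsto_atTop.1 (hspan y hy) (ε / 2) (by positivity)
  refine ⟨N, fun n hn => ?_⟩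
  have h1 := hN n hn
  rw [dist_zero_right] at h1 ⊢
  have h2 : ‖L n (x - y)‖ < ε / 2 := by
    refine (hC' n _).trans_lt ?_
    rw [dist_eq_norm, lt_div_iff₀ hpos] at hxy
    linarith
  calc ‖L n x‖ = ‖L n (x - y) + L n y‖ := by rw [← map_add]; simp
    _ ≤ ‖L n (x - y)‖ + ‖L n y‖ := norm_add_le _ _
    _ < ε := by linarith

variable [MeasurableSpace K] [BorelSpace K]

/-- Translating by `t` with `χ t ≠ 1` multiplies the integral by `χ t` but leaves it unchanged. -/
theorem integral_character_eq_zero {K : Type*} [CommGroup K] [TopologicalSpace K]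
    [IsTopologicalGroup K] [MeasurableSpace K] [BorelSpace K] (μ : Measure K) [μ.IsHaarMeasure]
    (χ : K →ₜ* Circle) (hχ : χ ≠ 1) :
    ∫ x, (χ x : ℂ) ∂μ = 0 := by
  obtain ⟨t, ht⟩ : ∃ t, χ t ≠ 1 := by
    by_contra! h
    exact hχ (ContinuousMonoidHom.ext h)
  have h := integral_mul_left_eq_self (μ := μ) (fun x => (χ x : ℂ)) t
  simp only [map_mul, Circle.coe_mul] at h
  rw [integral_const_mul] at h
  have h2 : ((χ t : ℂ) - 1) * ∫ x, (χ x : ℂ) ∂μ = 0 := by rw [sub_mul, h]; ring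
  rcases mul_eq_zero.1 h2 with h3 | h3
  · exact absurd (Circle.ext (by simpa using sub_eq_zero.1 h3)) ht
  · exact h3

theorem ContinuousMap.integrable_of_compact {X : Type*} [TopologicalSpace X] [CompactSpace X]
    [MeasurableSpace X] [BorelSpace X] (μ : Measure X) [IsFiniteMeasure μ] (f : C(X, ℂ)) :
    Integrable f μ :=
  f.continuous.integrable_of_hasCompactSupport (HasCompactSupport.of_compactSpace f)

theorem ContinuousMap.norm_integral_le_of_compact {X : Type*} [TopologicalSpace X] [CompactSpace X]
    [MeasurableSpace X] (μ : Measure X) [IsProbabilityMeasure μ] (f : C(X, ℂ)) :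
    ‖∫ x, f x ∂μ‖ ≤ ‖f‖ := by
  simpa using norm_integral_le_of_norm_le_const (μ := μ) (C := ‖f‖)
    (Eventually.of_forall fun x => f.norm_coe_le_norm x)

/-- A separating subgroup of characters of a compact group contains all characters. -/
theorem mem_of_separating (μ : Measure K) [IsProbabilityMeasure μ]
    [μ.IsHaarMeasure]
    (D : Subgroup (K →ₜ* Circle))
    (hD : ∀ x y : K, x ≠ y → ∃ χ ∈ D, χ x ≠ χ y) (ψ : K →ₜ* Circle) : ψ ∈ D := by
  by_contra hψ
  -- The Fourier coefficient at `ψ`: by orthogonality it kills `D`, hence a dense subspace, yet it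
  -- is 1 at `ψ`.
  let L : C(K, ℂ) →ₗ[ℂ] ℂ :=
    { toFun := fun f => ∫ x, (ψ⁻¹.toComplexMap * f) x ∂μ
      map_add' := fun f g => by
        rw [mul_add]
        exact integral_add (ContinuousMap.integrable_of_compact μ _)
          (ContinuousMap.integrable_of_compact μ _)
      map_smul' := fun c f => by
        simp [integral_const_mul] }
  have hnorm : ‖ψ⁻¹.toComplexMap‖ ≤ 1 := by
    rw [ContinuousMap.norm_le _ zero_le_one]
    exact fun x => (Circle.norm_coe _).le
  have key := tendsto_zero_of_span_dense (fun _ => L) 1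
    (fun _ f => (ContinuousMap.norm_integral_le_of_compact μ _).trans
      ((norm_mul_le _ _).trans (mul_le_mul_of_nonneg_right hnorm (norm_nonneg _)))) _
    (span_characters_dense D hD) (by
      rintro _ ⟨χ, hχ, rfl⟩
      have : L χ.toComplexMap = 0 := by
        have := integral_character_eq_zero μ (ψ⁻¹ * χ) (fun h => hψ (by
          rw [inv_mul_eq_one] at h; exact h ▸ hχ))
        simpa [L, ContinuousMonoidHom.toComplexMap] using this
      simp [this]) ψ.toComplexMap
  have h1 : L ψ.toComplexMap = 1 := by
    simp [L, ContinuousMonoidHom.toComplexMap, ContinuousMonoidHom.circle_inv_apply]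
  rw [h1] at key
  exact one_ne_zero (tendsto_nhds_unique tendsto_const_nhds key)

/-- A sequence of endomorphisms of a compact group is mixing as soon as it eventually moves each
nontrivial character away from every given character. -/
theorem tendsto_integral_comp_mul (μ : Measure K) [IsProbabilityMeasure μ]
    [μ.IsHaarMeasure]
    (hK : ∀ x y : K, x ≠ y → ∃ χ : K →ₜ* Circle, χ x ≠ χ y) (s : ℕ → K →ₜ* K)
    (hs : ∀ χ ψ : K →ₜ* Circle, χ ≠ 1 → ∀ᶠ n in atTop, χ.comp (s n) ≠ ψ) (f g : C(K, ℂ)) :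
    Tendsto (fun n => ∫ x, f (s n x) * g x ∂μ - (∫ x, f x ∂μ) * ∫ x, g x ∂μ) atTop (𝓝 0) := by
  have hdense := span_characters_dense (⊤ : Subgroup (K →ₜ* Circle))
    (fun x y hxy => (hK x y hxy).imp fun χ h => ⟨trivial, h⟩)
  have hint : ∀ (n : ℕ) (f g : C(K, ℂ)), Integrable (fun x => f (s n x) * g x) μ := fun n f g =>
    ContinuousMap.integrable_of_compact μ ((f.comp (s n : C(K, K))) * g)
  have hint' : ∀ f : C(K, ℂ), Integrable (fun x => f x) μ :=
    fun f => ContinuousMap.integrable_of_compact μ f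
  have hle : ∀ (n : ℕ) (f g : C(K, ℂ)),
      ‖∫ x, f (s n x) * g x ∂μ - (∫ x, f x ∂μ) * ∫ x, g x ∂μ‖ ≤ 2 * ‖f‖ * ‖g‖ := by
    intro n f g
    have h1 : ‖∫ x, f (s n x) * g x ∂μ‖ ≤ ‖f‖ * ‖g‖ := by
      simpa using norm_integral_le_of_norm_le_const (μ := μ) (C := ‖f‖ * ‖g‖)
        (f := fun x => f (s n x) * g x) (Eventually.of_forall fun x => by
          rw [norm_mul]
          exact mul_le_mul (f.norm_coe_le_norm _) (g.norm_coe_le_norm _) (norm_nonneg _)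
            (norm_nonneg _))
    have h2 : ‖(∫ x, f x ∂μ) * ∫ x, g x ∂μ‖ ≤ ‖f‖ * ‖g‖ := by
      rw [norm_mul]
      exact mul_le_mul (ContinuousMap.norm_integral_le_of_compact μ f)
        (ContinuousMap.norm_integral_le_of_compact μ g) (norm_nonneg _) (norm_nonneg _)
    linarith [norm_sub_le (∫ x, f (s n x) * g x ∂μ) ((∫ x, f x ∂μ) * ∫ x, g x ∂μ)]
  let B : ℕ → C(K, ℂ) →ₗ[ℂ] C(K, ℂ) →ₗ[ℂ] ℂ := fun n => LinearMap.mk₂ ℂ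
    (fun f g => ∫ x, f (s n x) * g x ∂μ - (∫ x, f x ∂μ) * ∫ x, g x ∂μ)
    (fun f f' g => by
      simp only [ContinuousMap.add_apply, add_mul]
      rw [integral_add (hint n f g) (hint n f' g), integral_add (hint' f) (hint' f')]
      ring)
    (fun c f g => by
      simp only [ContinuousMap.smul_apply, smul_eq_mul, mul_assoc, integral_const_mul]
      ring)
    (fun f g g' => by
      simp only [ContinuousMap.add_apply, mul_add]
      rw [integral_add (hint n f g) (hint n f g'), integral_add (hint' g) (hint' g')]
      ring)
    (fun c f g => by
      simp only [ContinuousMap.smul_apply, smul_eq_mul, mul_left_comm _ c, integral_const_mul]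
      ring)
  -- Density is applied in each variable in turn, reducing to a pair of characters.
  refine tendsto_zero_of_span_dense (fun n => B n f) (2 * ‖f‖) (fun n g => hle n f g) _ hdense ?_ g
  rintro _ ⟨ψ, -, rfl⟩
  refine tendsto_zero_of_span_dense (fun n => (B n).flip ψ.toComplexMap) (2 * ‖ψ.toComplexMap‖)
    (fun n f => (hle n f _).trans (le_of_eq (by ring))) _ hdense ?_ f
  rintro _ ⟨χ, -, rfl⟩
  by_cases hχ : χ = 1
  · subst hχ
    refine tendsto_const_nhds.congr fun n => ?_
    simp [B, ContinuousMonoidHom.toComplexMap]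
  · refine tendsto_const_nhds.congr' ?_
    filter_upwards [hs χ ψ⁻¹ hχ] with n hn
    have h1 := integral_character_eq_zero μ χ hχ
    have h2 := integral_character_eq_zero μ (χ.comp (s n) * ψ) (fun h => hn (eq_inv_of_mul_eq_one_left h))
    simp only [ContinuousMonoidHom.mul_apply, ContinuousMonoidHom.comp_toFun, Circle.coe_mul] at h2
    simp [B, ContinuousMonoidHom.toComplexMap, h1, h2]

/-- Topological mixing. -/
theorem eventually_inter_preimage_nonempty [T2Space K] (μ : Measure K) [IsProbabilityMeasure μ]
    [μ.IsHaarMeasure]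
    (hK : ∀ x y : K, x ≠ y → ∃ χ : K →ₜ* Circle, χ x ≠ χ y) (s : ℕ → K →ₜ* K)
    (hs : ∀ χ ψ : K →ₜ* Circle, χ ≠ 1 → ∀ᶠ n in atTop, χ.comp (s n) ≠ ψ) (U W : Set K)
    (hU : IsOpen U) (hW : IsOpen W) (hU' : U.Nonempty) (hW' : W.Nonempty) :
    ∀ᶠ n in atTop, (W ∩ s n ⁻¹' U).Nonempty := by
  have bump : ∀ U : Set K, IsOpen U → U.Nonempty → ∃ f : C(K, ℂ), (∀ x ∉ U, f x = 0) ∧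
      ∫ x, f x ∂μ ≠ 0 := by
    rintro U hU ⟨x₀, hx₀⟩
    obtain ⟨f, hf0, hf1, hf⟩ := exists_continuous_zero_one_of_isClosed hU.isClosed_compl
      (isClosed_singleton (x := x₀)) (by simpa using hx₀)
    refine ⟨⟨fun x => (f x : ℂ), by fun_prop⟩, fun x hx => by simpa using hf0 hx, ?_⟩
    have hx1 : f x₀ = 1 := hf1 rfl
    have : 0 < ∫ x, f x ∂μ := by
      refine f.continuous.integral_pos_of_hasCompactSupport_nonneg_nonzero
        (HasCompactSupport.of_compactSpace f) (fun x => (hf x).1) (x := x₀) (by simp [hx1])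
    simp only [ContinuousMap.coe_mk, integral_complex_ofReal]
    exact_mod_cast this.ne'
  obtain ⟨f, hf, hf'⟩ := bump U hU hU'
  obtain ⟨g, hg, hg'⟩ := bump W hW hW'
  have h := tendsto_integral_comp_mul μ hK s hs f g
  -- This nonzero value is what the correlation would equal if the intersection were empty.
  have h2 : ∀ᶠ n in atTop, ∫ x, f (s n x) * g x ∂μ - (∫ x, f x ∂μ) * ∫ x, g x ∂μ ≠
      -((∫ x, f x ∂μ) * ∫ x, g x ∂μ) :=
    h.eventually_ne (neg_ne_zero.2 (mul_ne_zero hf' hg')).symm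
  filter_upwards [h2] with n hn
  by_contra hne
  apply hn
  have : ∀ x, f (s n x) * g x = 0 := by
    intro x
    by_cases hx : x ∈ W
    · rw [hf _ fun hx' => hne ⟨x, hx, hx'⟩, zero_mul]
    · rw [hg _ hx, mul_zero]
  simp [this]

end Mixing

/-! ### Independent sequences and copies of `ℓ¹`. -/

section Independence

open Filter Topology

/-- A topologically mixing sequence of continuous maps has a subsequence along which every pair
of nonempty open sets is independent. -/
theorem exists_independent_subsequence {X : Type*} [TopologicalSpace X] [Nonempty X]
    (s : ℕ → X → X) (hc : ∀ n, Continuous (s n))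
    (hmix : ∀ U W : Set X, IsOpen U → IsOpen W → U.Nonempty → W.Nonempty →
      ∀ᶠ n in atTop, (W ∩ s n ⁻¹' U).Nonempty)
    (U : Bool → Set X) (hU : ∀ b, IsOpen (U b)) (hU' : ∀ b, (U b).Nonempty) :
    ∃ n : ℕ → ℕ, ∀ (k : ℕ) (ε : ℕ → Bool), ∃ x, ∀ i < k, s (n i) x ∈ U (ε i) := by
  let State := {F : Set (Set X) // F.Finite ∧ ∀ W ∈ F, IsOpen W ∧ W.Nonempty}
  have hstep : ∀ F : State, ∃ n, ∀ W ∈ F.1, ∀ b, (W ∩ s n ⁻¹' U b).Nonempty := by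
    intro F
    have : ∀ᶠ n in atTop, ∀ W ∈ F.1, ∀ b, (W ∩ s n ⁻¹' U b).Nonempty := by
      rw [eventually_all_finite F.2.1]
      intro W hW
      rw [eventually_all]
      exact fun b => hmix _ _ (hU b) (F.2.2 W hW).1 (hU' b) (F.2.2 W hW).2
    exact this.exists
  choose m hm using hstep
  -- Each stage splits every set of the family by both `U true` and `U false`, so all sign patterns
  -- stay realised by nonempty open sets.
  let next : State → State := fun F =>
    ⟨⋃ b : Bool, (fun W => W ∩ s (m F) ⁻¹' U b) '' F.1,
      Set.finite_iUnion fun b => F.2.1.image _, by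
        intro W hW
        obtain ⟨b, V, hV, rfl⟩ := Set.mem_iUnion.1 hW
        exact ⟨(F.2.2 V hV).1.inter ((hU b).preimage (hc _)), hm F V hV b⟩⟩
  let init : State := ⟨{Set.univ}, Set.finite_singleton _, by simp⟩
  let F : ℕ → State := fun k => next^[k] init
  refine ⟨fun k => m (F k), fun k ε => ?_⟩
  have key : ∀ k, ∃ W ∈ (F k).1, ∀ x ∈ W, ∀ i < k, s (m (F i)) x ∈ U (ε i) := by
    intro k
    induction k with
    | zero => exact ⟨Set.univ, rfl, by simp⟩
    | succ k ih =>
      obtain ⟨W, hW, h⟩ := ih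
      refine ⟨W ∩ s (m (F k)) ⁻¹' U (ε k), ?_, ?_⟩
      · have : F (k + 1) = next (F k) := Function.iterate_succ_apply' _ _ _
        rw [this]
        exact Set.mem_iUnion.2 ⟨ε k, W, hW, rfl⟩
      · rintro x ⟨hx, hx'⟩ i hi
        rcases Nat.lt_succ_iff_lt_or_eq.1 hi with hi | rfl
        · exact h x hx i hi
        · exact hx'
  obtain ⟨W, hW, h⟩ := key k
  obtain ⟨x, hx⟩ := ((F k).2.2 W hW).2
  exact ⟨x, h x hx⟩

/-- A bounded sequence satisfying a lower `ℓ¹`-estimate spans an isomorphic copy of `ℓ¹`. -/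
theorem not_isRosenthalSpace_of_lower_estimate {V : Type*} [NormedAddCommGroup V]
    [NormedSpace ℝ V] [CompleteSpace V] (v : ℕ → V) (M : ℝ) (hM : ∀ i, ‖v i‖ ≤ M) (δ : ℝ)
    (hδ : 0 < δ)
    (h : ∀ (k : ℕ) (c : ℕ → ℝ),
      δ * ∑ i ∈ Finset.range k, |c i| ≤ ‖∑ i ∈ Finset.range k, c i • v i‖) :
    ¬ IsRosenthalSpace V := by
  have hnorm : ∀ x : lp (fun _ : ℕ => ℝ) 1, HasSum (fun i => |x i|) ‖x‖ := fun x => by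
    simpa using lp.hasSum_norm (p := 1) (by simp) x
  have hle : ∀ (x : lp (fun _ : ℕ => ℝ) 1) i, ‖x i • v i‖ ≤ |x i| * M := fun x i => by
    rw [norm_smul, Real.norm_eq_abs]
    exact mul_le_mul_of_nonneg_left (hM i) (abs_nonneg _)
  have hsum : ∀ x : lp (fun _ : ℕ => ℝ) 1, Summable fun i => x i • v i := fun x =>
    Summable.of_norm_bounded ((hnorm x).summable.mul_right M) (hle x)
  let T : lp (fun _ : ℕ => ℝ) 1 →ₗ[ℝ] V :=
    { toFun := fun x => ∑' i, x i • v i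
      map_add' := fun x y => by
        simp only [lp.coeFn_add, Pi.add_apply, add_smul]
        exact (hsum x).tsum_add (hsum y)
      map_smul' := fun c x => by
        simp only [lp.coeFn_smul, Pi.smul_apply, smul_eq_mul, mul_smul, RingHom.id_apply]
        exact (hsum x).tsum_const_smul c }
  have hT : ∀ x, ‖T x‖ ≤ M * ‖x‖ := fun x => by
    rw [mul_comm]
    exact tsum_of_norm_bounded ((hnorm x).mul_right M) (hle x)
  intro hV
  refine hV ⟨T.mkContinuous M hT, δ, hδ, fun x => ?_⟩
  exact le_of_tendsto_of_tendsto' ((hnorm x).tendsto_sum_nat.const_mul δ)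
    (hsum x).hasSum.tendsto_sum_nat.norm (fun k => h k x)

/-- If a linear isometric cascade over a topologically mixing system has a bounded equivariant
family of functionals which is weak-star continuous and not constant, then the Banach space is not
Rosenthal. -/
theorem not_isRosenthalSpace_of_mixing {X V : Type*} [TopologicalSpace X] [NormedAddCommGroup V]
    [NormedSpace ℝ V] [CompleteSpace V] (s : ℕ → X → X) (hc : ∀ n, Continuous (s n))
    (hmix : ∀ U W : Set X, IsOpen U → IsOpen W → U.Nonempty → W.Nonempty →
      ∀ᶠ n in atTop, (W ∩ s n ⁻¹' U).Nonempty)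
    (φ : X → StrongDual ℝ V) (hφ : ∀ v, Continuous fun x => φ x v) (C : ℝ)
    (hC : ∀ x, ‖φ x‖ ≤ C) (S : ℕ → V → V) (hS : ∀ n v, ‖S n v‖ = ‖v‖)
    (hequiv : ∀ n x v, φ (s n x) v = φ x (S n v)) (p q : X) (hpq : φ p ≠ φ q) :
    ¬ IsRosenthalSpace V := by
  obtain ⟨v, hv⟩ : ∃ v, φ p v < φ q v := by
    obtain ⟨w, hw⟩ : ∃ w, φ p w ≠ φ q w := by
      by_contra! h
      exact hpq (ContinuousLinearMap.ext h)
    rcases lt_or_gt_of_ne hw with h | h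
    · exact ⟨w, h⟩
    · exact ⟨-w, by simpa using h⟩
  obtain ⟨a, ha, ha'⟩ := exists_between hv
  obtain ⟨b, hab, hb⟩ := exists_between ha'
  have : Nonempty X := ⟨p⟩
  obtain ⟨n, hn⟩ := exists_independent_subsequence s hc hmix
    (fun t => if t then {x | b < φ x v} else {x | φ x v < a})
    (by rintro (_ | _) <;> simp <;> [exact isOpen_lt (hφ v) continuous_const;
          exact isOpen_lt continuous_const (hφ v)])
    (by rintro (_ | _) <;> simp <;> [exact ⟨p, ha⟩; exact ⟨q, hb⟩])
  have hC0 : 0 ≤ C := (norm_nonneg _).trans (hC p)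
  -- The gap `b - a` is divided by twice the norm bound, since two functionals are compared; the `+
  -- 1` keeps the denominator positive.
  refine not_isRosenthalSpace_of_lower_estimate (fun i => S (n i) v) ‖v‖ (fun i => (hS _ _).le)
    ((b - a) / (2 * (C + 1))) (div_pos (sub_pos.2 hab) (by positivity)) fun k c => ?_
  -- `x` follows the signs of `c` and `y` the opposite signs, so every term of the difference is at
  -- least `(b - a) * |c i|`.
  obtain ⟨x, hx⟩ := hn k (fun i => decide (0 ≤ c i))
  obtain ⟨y, hy⟩ := hn k (fun i => !decide (0 ≤ c i))
  have hbd : ∀ z, |∑ i ∈ Finset.range k, c i * φ (s (n i) z) v| ≤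
      (C + 1) * ‖∑ i ∈ Finset.range k, c i • S (n i) v‖ := fun z => by
    have h1 : ∑ i ∈ Finset.range k, c i * φ (s (n i) z) v =
        φ z (∑ i ∈ Finset.range k, c i • S (n i) v) := by
      simp [map_sum, hequiv]
    rw [h1, ← Real.norm_eq_abs]
    refine ((φ z).le_opNorm _).trans (mul_le_mul_of_nonneg_right ?_ (norm_nonneg _))
    linarith [hC z]
  have hlow : (b - a) * ∑ i ∈ Finset.range k, |c i| ≤
      ∑ i ∈ Finset.range k, c i * φ (s (n i) x) v - ∑ i ∈ Finset.range k, c i * φ (s (n i) y) v := by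
    rw [Finset.mul_sum, ← Finset.sum_sub_distrib]
    refine Finset.sum_le_sum fun i hi => ?_
    have hxi := hx i (Finset.mem_range.1 hi)
    have hyi := hy i (Finset.mem_range.1 hi)
    rcases le_or_gt 0 (c i) with h0 | h0
    · simp only [h0, decide_true, if_true, Bool.not_true, Bool.false_eq_true, if_false,
        Set.mem_ofPred_eq] at hxi hyi
      rw [abs_of_nonneg h0]
      nlinarith
    · simp only [not_le.2 h0, decide_false, if_true, Bool.not_false, Bool.false_eq_true, if_false,
        Set.mem_ofPred_eq] at hxi hyi
      rw [abs_of_neg h0]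
      nlinarith
  rw [div_mul_eq_mul_div, div_le_iff₀ (by positivity)]
  linarith [hbd x, hbd y, le_abs_self (∑ i ∈ Finset.range k, c i * φ (s (n i) x) v),
    neg_abs_le (∑ i ∈ Finset.range k, c i * φ (s (n i) y) v)]

end Independence

/-! ### Characters of the torus and mixing of hyperbolic automorphisms. -/

section TorusCharacters

open Filter Topology MeasureTheory

/-- The monomial character of the torus with exponent vector `m`. -/
noncomputable def Torus2.monomial (m : Fin 2 → ℤ) : Torus2 →ₜ* Circle where
  toFun z := ∏ j, z j ^ m j
  map_one' := by simp
  map_mul' z w := by simp [mul_zpow, Finset.prod_mul_distrib]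
  continuous_toFun := by fun_prop

theorem Torus2.monomial_apply (m : Fin 2 → ℤ) (z : Torus2) :
    Torus2.monomial m z = ∏ j, z j ^ m j := rfl

theorem Torus2.monomial_add (m n : Fin 2 → ℤ) :
    Torus2.monomial (m + n) = Torus2.monomial m * Torus2.monomial n := by
  ext z
  simp [Torus2.monomial_apply, zpow_add, Finset.prod_mul_distrib]

theorem Torus2.monomial_zero : Torus2.monomial 0 = 1 := by
  ext z
  simp [Torus2.monomial_apply]

theorem Torus2.monomial_neg (m : Fin 2 → ℤ) :
    Torus2.monomial (-m) = (Torus2.monomial m)⁻¹ := by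
  rw [eq_inv_iff_mul_eq_one, ← Torus2.monomial_add, neg_add_cancel, Torus2.monomial_zero]

theorem Torus2.monomial_single (j : Fin 2) (z : Torus2) :
    Torus2.monomial (Pi.single j 1) z = z j := by
  rw [Torus2.monomial_apply, Finset.prod_eq_single j]
  · simp
  · intro i _ hij
    simp [Pi.single_eq_of_ne hij]
  · simp

/-- The monomials form a subgroup containing the coordinates, so they separate points and
`mem_of_separating` applies. -/
theorem Torus2.exists_monomial_eq (χ : Torus2 →ₜ* Circle) : ∃ m, χ = Torus2.monomial m := by
  let D : Subgroup (Torus2 →ₜ* Circle) :=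
    { carrier := Set.range Torus2.monomial
      one_mem' := ⟨0, Torus2.monomial_zero⟩
      mul_mem' := by
        rintro _ _ ⟨m, rfl⟩ ⟨n, rfl⟩
        exact ⟨m + n, Torus2.monomial_add m n⟩
      inv_mem' := by
        rintro _ ⟨m, rfl⟩
        exact ⟨-m, Torus2.monomial_neg m⟩ }
  let _ : MeasurableSpace Torus2 := borel Torus2
  have _ : BorelSpace Torus2 := ⟨rfl⟩
  have _ : IsProbabilityMeasure (Measure.haarMeasure (⊤ : TopologicalSpace.PositiveCompacts Torus2)) :=
    ⟨by simpa using Measure.haarMeasure_self (K₀ := (⊤ : TopologicalSpace.PositiveCompacts Torus2))⟩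
  obtain ⟨m, hm⟩ := mem_of_separating
    (Measure.haarMeasure (⊤ : TopologicalSpace.PositiveCompacts Torus2)) D
    (fun x y hxy => by
      obtain ⟨j, hj⟩ := Function.ne_iff.1 hxy
      exact ⟨_, ⟨Pi.single j 1, rfl⟩, by simpa only [Torus2.monomial_single] using hj⟩) χ
  exact ⟨m, hm.symm⟩

theorem Torus2.monomial_eq_one_iff (m : Fin 2 → ℤ) : Torus2.monomial m = 1 ↔ m = 0 := by
  refine ⟨fun h => ?_, fun h => h ▸ Torus2.monomial_zero⟩
  funext j
  by_contra hj
  have hj' : (m j : ℝ) ≠ 0 := by exact_mod_cast hj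
  -- At this point the monomial takes the value `exp (iπ) = -1`.
  have h1 := DFunLike.congr_fun h (Pi.mulSingle j (Circle.exp (Real.pi / m j)))
  rw [Torus2.monomial_apply, Finset.prod_eq_single j (fun i _ hij => by
    rw [Pi.mulSingle_eq_of_ne hij, one_zpow]) (by simp), Pi.mulSingle_eq_same,
    ← Circle.exp_zsmul, zsmul_eq_mul, mul_div_cancel₀ _ hj'] at h1
  have h2 : (Circle.exp Real.pi : ℂ) = 1 := congrArg (fun z : Circle => (z : ℂ)) h1
  rw [Circle.coe_exp, Complex.exp_pi_mul_I] at h2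
  norm_num at h2

theorem Torus2.monomial_injective : Function.Injective Torus2.monomial := by
  intro m n h
  have : Torus2.monomial (m + -n) = 1 := by
    rw [Torus2.monomial_add, Torus2.monomial_neg, h, mul_inv_cancel]
  rw [Torus2.monomial_eq_one_iff] at this
  exact add_neg_eq_zero.1 this

/-- The iterates of a continuous endomorphism. -/
def ContinuousMonoidHom.iter {K : Type*} [Monoid K] [TopologicalSpace K] (f : K →ₜ* K) (n : ℕ) :
    K →ₜ* K where
  toFun := f^[n]
  map_one' := iterate_map_one f n
  map_mul' := iterate_map_mul f n
  continuous_toFun := f.continuous_toFun.iterate n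

theorem Torus2.monomial_comp_iter (f : Torus2 →ₜ* Torus2) (A : Matrix (Fin 2) (Fin 2) ℤ)
    (hA : ∀ (z : Torus2) (i : Fin 2), f z i = ∏ j, z j ^ A i j) (m : Fin 2 → ℤ) (n : ℕ) :
    (Torus2.monomial m).comp (f.iter n) = Torus2.monomial (Matrix.vecMul m (A ^ n)) := by
  have h1 : ∀ (m : Fin 2 → ℤ) z, Torus2.monomial m (f z) = Torus2.monomial (Matrix.vecMul m A) z := by
    intro m z
    simp only [Torus2.monomial_apply, hA, Matrix.vecMul, dotProduct, Fin.prod_univ_two,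
      Fin.sum_univ_two, mul_zpow, zpow_add, ← zpow_mul]
    rw [mul_comm (m 0), mul_comm (m 0), mul_comm (m 1), mul_comm (m 1)]
    exact mul_mul_mul_comm _ _ _ _
  ext1 z
  change Torus2.monomial m (f^[n] z) = _
  induction n generalizing m z with
  | zero => simp
  | succ n ih =>
    rw [Function.iterate_succ_apply', h1, ih, Matrix.vecMul_vecMul, ← pow_succ']

/-- A fixed row vector puts 1 in the spectrum of `A ^ k`; by spectral mapping over `ℂ`, `A` has an
eigenvalue with `μ ^ k = 1`. -/
theorem Matrix.exists_eigenvalue_of_vecMul_pow (A : Matrix (Fin 2) (Fin 2) ℤ) (w : Fin 2 → ℤ)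
    (hw : w ≠ 0) (k : ℕ) (hk : 0 < k) (h : Matrix.vecMul w (A ^ k) = w) :
    ∃ μ : ℂ, Module.End.HasEigenvalue (Matrix.toLin' (A.map (Int.cast : ℤ → ℂ))) μ ∧ ‖μ‖ = 1 := by
  set B := A.map (Int.cast : ℤ → ℂ) with hB
  have hBk : B ^ k = (A ^ k).map (Int.cast : ℤ → ℂ) := by
    rw [hB]
    exact (Matrix.map_pow A (Int.castRingHom ℂ) k).symm
  let w' : Fin 2 → ℂ := fun i => (w i : ℂ)
  have hw' : w' ≠ 0 := fun h0 => hw (funext fun i => by simpa [w'] using congrFun h0 i)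
  have hfix : Matrix.vecMul w' (B ^ k) = w' := by
    rw [hBk]
    funext j
    have := congrFun h j
    simp only [Matrix.vecMul, dotProduct, Matrix.map_apply] at this ⊢
    simp only [w']
    exact_mod_cast this
  have hspec : (1 : ℂ) ∈ spectrum ℂ (B ^ k) := by
    rw [spectrum.mem_iff, map_one]
    intro hu
    apply hw'
    obtain ⟨u, hu⟩ := hu
    have h0 : Matrix.vecMul w' (1 - B ^ k) = 0 := by
      rw [Matrix.vecMul_sub, Matrix.vecMul_one, hfix, sub_self]
    calc w' = Matrix.vecMul (Matrix.vecMul w' (1 - B ^ k)) (↑u⁻¹ : Matrix (Fin 2) (Fin 2) ℂ) := by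
          rw [Matrix.vecMul_vecMul, ← hu, Units.mul_inv, Matrix.vecMul_one]
      _ = 0 := by rw [h0, Matrix.zero_vecMul]
  rw [spectrum.map_pow_of_pos _ hk] at hspec
  obtain ⟨μ, hμ, hμk⟩ := hspec
  refine ⟨μ, ?_, ?_⟩
  · rw [Module.End.hasEigenvalue_iff_mem_spectrum]
    rwa [Matrix.spectrum_toLin']
  · have : ‖μ‖ ^ k = 1 := by
      rw [← norm_pow]
      simp only at hμk
      rw [hμk, norm_one]
    exact (pow_eq_one_iff_of_nonneg (norm_nonneg _) hk.ne').1 this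

/-- A hyperbolic automorphism of the torus is topologically mixing. -/
theorem IsHyperbolicAut.mixing {σ : Torus2 ≃ₜ* Torus2} (hσ : IsHyperbolicAut σ) (U W : Set Torus2)
    (hU : IsOpen U) (hW : IsOpen W) (hU' : U.Nonempty) (hW' : W.Nonempty) :
    ∀ᶠ n in atTop, (W ∩ σ^[n] ⁻¹' U).Nonempty := by
  obtain ⟨A, hA, hyp⟩ := hσ
  let _ : MeasurableSpace Torus2 := borel Torus2
  have _ : BorelSpace Torus2 := ⟨rfl⟩
  have _ : IsProbabilityMeasure (Measure.haarMeasure (⊤ : TopologicalSpace.PositiveCompacts Torus2)) :=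
    ⟨by simpa using Measure.haarMeasure_self (K₀ := (⊤ : TopologicalSpace.PositiveCompacts Torus2))⟩
  refine eventually_inter_preimage_nonempty
    (Measure.haarMeasure (⊤ : TopologicalSpace.PositiveCompacts Torus2)) (fun x y hxy => ?_)
    (fun n => ContinuousMonoidHom.iter (σ : Torus2 →ₜ* Torus2) n) (fun χ ψ hχ => ?_) U W hU hW hU' hW'
  · obtain ⟨j, hj⟩ := Function.ne_iff.1 hxy
    exact ⟨Torus2.monomial (Pi.single j 1), by simpa only [Torus2.monomial_single] using hj⟩
  · by_contra hfreq
    have hfreq : ∃ᶠ n in atTop, χ.comp (ContinuousMonoidHom.iter (σ : Torus2 →ₜ* Torus2) n) = ψ := by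
      simpa [Filter.Frequently] using hfreq
    -- Two distinct times with the same composite character make `m A^n` a fixed row vector of `A ^
    -- (k + 1)`.
    obtain ⟨n, hn⟩ := hfreq.exists
    obtain ⟨n', hlt, hn'⟩ := Filter.frequently_atTop'.1 hfreq n
    obtain ⟨k, rfl⟩ := Nat.exists_eq_add_of_lt hlt
    obtain ⟨m, rfl⟩ := Torus2.exists_monomial_eq χ
    have hcomp := Torus2.monomial_comp_iter (σ : Torus2 →ₜ* Torus2) A hA m
    -- `σ^n` is surjective, so a nontrivial character stays nontrivial after composition.
    have hw : Matrix.vecMul m (A ^ n) ≠ 0 := by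
      intro h0
      apply hχ
      have h1 := hcomp n
      rw [h0, Torus2.monomial_zero] at h1
      ext1 z
      obtain ⟨y, rfl⟩ := σ.surjective.iterate n z
      exact DFunLike.congr_fun h1 y
    have hfix : Matrix.vecMul (Matrix.vecMul m (A ^ n)) (A ^ (k + 1)) = Matrix.vecMul m (A ^ n) := by
      apply Torus2.monomial_injective
      rw [Matrix.vecMul_vecMul, ← pow_add, ← hcomp, ← hcomp, hn, ← hn', add_assoc]
    obtain ⟨μ, hμ, hμ1⟩ := Matrix.exists_eigenvalue_of_vecMul_pow A _ hw (k + 1) k.succ_pos hfix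
    exact hyp μ hμ hμ1

end TorusCharacters

/-! ### Transporting Lie group structures along homeomorphisms. -/

section LieGroupTransfer

variable {E : Type*} [NormedAddCommGroup E] [NormedSpace ℝ E] {H : Type*} [TopologicalSpace H]

/-- The charted space structure pulled back along a homeomorphism. -/
@[reducible]
def Homeomorph.pullbackChartedSpace (H : Type*) [TopologicalSpace H] {G P : Type*}
    [TopologicalSpace G] [TopologicalSpace P] [ChartedSpace H P] (e : G ≃ₜ P) :
    ChartedSpace H G where
  atlas := e.transOpenPartialHomeomorph '' atlas H P
  chartAt x := e.transOpenPartialHomeomorph (chartAt H (e x))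
  mem_chart_source x := by simp
  chart_mem_atlas x := Set.mem_image_of_mem _ (chart_mem_atlas H (e x))

/-- In the transition maps `e` cancels against its inverse, leaving those of `P`. -/
theorem Homeomorph.isManifold_pullback (I : ModelWithCorners ℝ E H) (n : ℕ∞ω) {G P : Type*}
    [TopologicalSpace G] [TopologicalSpace P] [ChartedSpace H P] [IsManifold I n P] (e : G ≃ₜ P) :
    @IsManifold ℝ _ E _ _ H _ I n G _ (e.pullbackChartedSpace H) := by
  let _ := e.pullbackChartedSpace H
  have : HasGroupoid G (contDiffGroupoid n I) := by
    constructor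
    rintro _ _ ⟨c, hc, rfl⟩ ⟨c', hc', rfl⟩
    have h : (e.transOpenPartialHomeomorph c).symm ≫ₕ e.transOpenPartialHomeomorph c' =
        c.symm ≫ₕ c' := by
      ext x <;> simp
    rw [h]
    exact HasGroupoid.compatible hc hc'
  exact IsManifold.mk' I n G

/-- Read in the charts, `e` coincides with the identity of `P`. -/
theorem Homeomorph.contMDiff_pullback (I : ModelWithCorners ℝ E H) (n : ℕ∞ω) {G P : Type*}
    [TopologicalSpace G] [TopologicalSpace P] [ChartedSpace H P] [IsManifold I n P] (e : G ≃ₜ P) :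
    letI := e.pullbackChartedSpace H
    ContMDiff I I n e := by
  let _ := e.pullbackChartedSpace H
  have := e.isManifold_pullback I n
  have hchart : ∀ x : G, chartAt H x = e.transOpenPartialHomeomorph (chartAt H (e x)) :=
    fun _ => rfl
  rw [contMDiff_iff]
  refine ⟨e.continuous, fun x y => ?_⟩
  refine ((contMDiff_iff.1 (contMDiff_id (I := I) (M := P) (n := n))).2 (e x) y).congr_mono ?_ ?_
  · intro z hz
    simp [extChartAt, hchart]
  · intro z hz
    simpa [extChartAt, hchart] using hz

theorem Homeomorph.contMDiff_pullback_symm (I : ModelWithCorners ℝ E H) (n : ℕ∞ω) {G P : Type*}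
    [TopologicalSpace G] [TopologicalSpace P] [ChartedSpace H P] [IsManifold I n P] (e : G ≃ₜ P) :
    letI := e.pullbackChartedSpace H
    ContMDiff I I n e.symm := by
  let _ := e.pullbackChartedSpace H
  have := e.isManifold_pullback I n
  have hchart : ∀ x : G, chartAt H x = e.transOpenPartialHomeomorph (chartAt H (e x)) :=
    fun _ => rfl
  rw [contMDiff_iff]
  refine ⟨e.symm.continuous, fun x y => ?_⟩
  refine ((contMDiff_iff.1 (contMDiff_id (I := I) (M := P) (n := n))).2 x (e y)).congr_mono ?_ ?_
  · intro z hz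
    simp [extChartAt, hchart]
  · intro z hz
    simpa [extChartAt, hchart] using hz

theorem Homeomorph.lieGroup_pullback (I : ModelWithCorners ℝ E H) (n : ℕ∞ω) {G P : Type*} [Group G]
    [TopologicalSpace G] [TopologicalSpace P] [ChartedSpace H P] [IsManifold I n P] (e : G ≃ₜ P)
    (hmul : ContMDiff (I.prod I) I n fun p : P × P => e (e.symm p.1 * e.symm p.2))
    (hinv : ContMDiff I I n fun p : P => e (e.symm p)⁻¹) :
    @LieGroup ℝ _ H _ E _ _ I n G _ _ (e.pullbackChartedSpace H) := by
  let _ := e.pullbackChartedSpace H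
  have := e.isManifold_pullback I n
  have he := e.contMDiff_pullback I n
  have he' := e.contMDiff_pullback_symm I n
  refine { contMDiff_mul := ?_, contMDiff_inv := ?_ }
  · have h := he'.comp (hmul.comp (he.prodMap he))
    refine h.congr fun p => ?_
    simp
  · have h := he'.comp (hinv.comp he)
    refine h.congr fun p => ?_
    simp

variable {M : Type*} [TopologicalSpace M] [ChartedSpace H M] {I : ModelWithCorners ℝ E H}

theorem contMDiff_of_eventually_const {E' : Type*} [NormedAddCommGroup E'] [NormedSpace ℝ E']
    {H' : Type*} [TopologicalSpace H'] {I' : ModelWithCorners ℝ E' H'} {N : Type*}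
    [TopologicalSpace N] [DiscreteTopology N] [ChartedSpace H' N] {n : ℕ∞ω} {f : M → N}
    (hf : Continuous f) : ContMDiff I I' n f := fun x => by
  refine (contMDiffAt_const (c := f x)).congr_of_eventuallyEq ?_
  exact hf.continuousAt.eventually (mem_nhds_discrete.2 (rfl : f x = f x)) |>.mono
    fun _ h => h.symm

theorem ContMDiff.zpow_of_lieGroup {E' : Type*} [NormedAddCommGroup E'] [NormedSpace ℝ E']
    {H' : Type*} [TopologicalSpace H'] {I' : ModelWithCorners ℝ E' H'} {N : Type*} [CommGroup N]
    [TopologicalSpace N] [ChartedSpace H' N] {n : ℕ∞ω} [LieGroup I' n N] {f : M → N}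
    (hf : ContMDiff I I' n f) (a : ℤ) : ContMDiff I I' n fun x => f x ^ a := by
  cases a with
  | ofNat k => simpa using hf.pow k
  | negSucc k => simpa using (hf.pow (k + 1)).inv

/-- A power of a smooth map whose integer exponent is locally constant is smooth. -/
theorem ContMDiff.zpow_discrete {E' : Type*} [NormedAddCommGroup E'] [NormedSpace ℝ E']
    {H' : Type*} [TopologicalSpace H'] {I' : ModelWithCorners ℝ E' H'} {N : Type*} [CommGroup N]
    [TopologicalSpace N] [ChartedSpace H' N] {n : ℕ∞ω} [LieGroup I' n N] {f : M → N}
    (hf : ContMDiff I I' n f) {a : M → ℤ} (ha : Continuous a) :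
    ContMDiff I I' n fun x => f x ^ a x := fun x => by
  refine (hf.zpow_of_lieGroup (a x) x).congr_of_eventuallyEq ?_
  filter_upwards [ha.continuousAt.eventually (mem_nhds_discrete.2 (rfl : a x = a x))] with y hy
  rw [hy]

end LieGroupTransfer

/-! ### The group `𝕋² ⋊ ℤ` and its coset space. -/

section ToralGroup

open Topology

variable (σ : Torus2 ≃ₜ* Torus2)

theorem iterateHom_continuous (k : Multiplicative ℤ) : Continuous (iterateHom σ k) := by
  -- Bicontinuous automorphisms form a subgroup, which handles negative iterates as well.
  let S : Subgroup (MulAut Torus2) :=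
    { carrier := {f | Continuous f ∧ Continuous f.symm}
      one_mem' := ⟨continuous_id, continuous_id⟩
      mul_mem' := fun ha hb => ⟨ha.1.comp hb.1, hb.2.comp ha.2⟩
      inv_mem' := fun ha => ⟨ha.2, ha.1⟩ }
  have hσ : σ.toMulEquiv ∈ S := ⟨σ.continuous_toFun, σ.continuous_invFun⟩
  exact (S.zpow_mem hσ k.toAdd).1

/-- The iterates of a toral automorphism are monomial maps. -/
theorem exists_iterateHom_eq_monomial : ∃ m : Multiplicative ℤ → Fin 2 → Fin 2 → ℤ,
    ∀ k (w : Torus2) i, iterateHom σ k w i = w 0 ^ m k i 0 * w 1 ^ m k i 1 := by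
  have h : ∀ (k : Multiplicative ℤ) (i : Fin 2), ∃ m : Fin 2 → ℤ, ∀ w : Torus2,
      iterateHom σ k w i = w 0 ^ m 0 * w 1 ^ m 1 := by
    intro k i
    let χ : Torus2 →ₜ* Circle :=
      { toFun := fun w => iterateHom σ k w i
        map_one' := by simp
        map_mul' := by simp
        continuous_toFun := (continuous_apply i).comp (iterateHom_continuous σ k) }
    obtain ⟨m, hm⟩ := Torus2.exists_monomial_eq χ
    refine ⟨m, fun w => ?_⟩
    have := DFunLike.congr_fun hm w
    rw [Torus2.monomial_apply, Fin.prod_univ_two] at this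
    exact this
  choose m hm using h
  exact ⟨m, fun k w i => hm k i w⟩

/-- The underlying space of `𝕋² ⋊ ℤ` is the product of its factors. -/
def ToralGroup.homeomorphProd : ToralGroup σ ≃ₜ (Circle × Circle) × Multiplicative ℤ where
  toFun g := ((g.left 0, g.left 1), g.right)
  invFun p := ⟨![p.1.1, p.1.2], p.2⟩
  left_inv g := by
    ext i
    · fin_cases i <;> rfl
    · rfl
  right_inv p := rfl
  continuous_toFun := by
    have h : Continuous fun g : ToralGroup σ => (g.left, g.right) := continuous_induced_dom
    have h1 := continuous_fst.comp h
    exact (((continuous_apply 0).comp h1).prodMk ((continuous_apply 1).comp h1)).prodMk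
      (continuous_snd.comp h)
  continuous_invFun := by
    rw [continuous_induced_rng]
    refine Continuous.prodMk ?_ continuous_snd
    refine continuous_pi fun i => ?_
    fin_cases i
    · exact continuous_fst.comp continuous_fst
    · exact continuous_snd.comp continuous_fst

/-- In coordinates the group operations are monomials in the circle variables with exponents locally
constant in the `ℤ`-coordinates. The dimension is `1 + 1 + 0`, with `ℤ` modelled on a point. -/
theorem ToralGroup.isLieGroupOfDim_two : IsLieGroupOfDim 2 (ToralGroup σ) := by
  let e := ToralGroup.homeomorphProd σ
  refine ⟨e.symm.t2Space, e.secondCountableTopology, ?_⟩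
  let _ : ChartedSpace Unit (Multiplicative ℤ) := ChartedSpace.ofDiscreteTopology
  have _ : IsManifold 𝓘(ℝ, Unit) ∞ (Multiplicative ℤ) := IsManifold.of_discreteTopology _
  have _ : LieGroup (𝓡 1) ∞ Circle := LieGroup.of_le (n := ω) le_top
  obtain ⟨m, hm⟩ := exists_iterateHom_eq_monomial σ
  refine ⟨(EuclideanSpace ℝ (Fin 1) × EuclideanSpace ℝ (Fin 1)) × Unit, inferInstance,
    inferInstance, ModelProd (ModelProd (EuclideanSpace ℝ (Fin 1)) (EuclideanSpace ℝ (Fin 1))) Unit,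
    inferInstance, ((𝓡 1).prod (𝓡 1)).prod 𝓘(ℝ, Unit), e.pullbackChartedSpace _, inferInstance,
    inferInstance, ?_, ?_⟩
  · simp [Module.finrank_zero_of_subsingleton]
  have hcont : ∀ {X : Type} [TopologicalSpace X] {f : X → Multiplicative ℤ} (_ : Continuous f)
      (i j : Fin 2), Continuous fun x => m (f x) i j := fun hf i j =>
    (continuous_of_discreteTopology (f := fun k => m k i j)).comp hf
  refine e.lieGroup_pullback _ ∞ ?_ ?_
  · have hz : ContMDiff ((((𝓡 1).prod (𝓡 1)).prod 𝓘(ℝ, Unit)).prod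
        (((𝓡 1).prod (𝓡 1)).prod 𝓘(ℝ, Unit))) ((𝓡 1).prod (𝓡 1)) ∞
        fun p : ((Circle × Circle) × Multiplicative ℤ) × ((Circle × Circle) × Multiplicative ℤ) =>
          p.1.1 := contMDiff_fst.comp contMDiff_fst
    have hw : ContMDiff ((((𝓡 1).prod (𝓡 1)).prod 𝓘(ℝ, Unit)).prod
        (((𝓡 1).prod (𝓡 1)).prod 𝓘(ℝ, Unit))) ((𝓡 1).prod (𝓡 1)) ∞
        fun p : ((Circle × Circle) × Multiplicative ℤ) × ((Circle × Circle) × Multiplicative ℤ) =>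
          p.2.1 := contMDiff_fst.comp contMDiff_snd
    have hk : Continuous
        fun p : ((Circle × Circle) × Multiplicative ℤ) × ((Circle × Circle) × Multiplicative ℤ) =>
          p.1.2 := continuous_snd.comp continuous_fst
    have hk' : Continuous
        fun p : ((Circle × Circle) × Multiplicative ℤ) × ((Circle × Circle) × Multiplicative ℤ) =>
          p.1.2 * p.2.2 := hk.mul (continuous_snd.comp continuous_snd)
    have h := ((hz.fst.mul ((hw.fst.zpow_discrete (hcont hk 0 0)).mul
      (hw.snd.zpow_discrete (hcont hk 0 1)))).prodMk
      (hz.snd.mul ((hw.fst.zpow_discrete (hcont hk 1 0)).mul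
      (hw.snd.zpow_discrete (hcont hk 1 1))))).prodMk
      (contMDiff_of_eventually_const (I' := 𝓘(ℝ, Unit)) hk')
    refine h.congr fun p => ?_
    simp [e, ToralGroup.homeomorphProd, hm]
  · have hz : ContMDiff (((𝓡 1).prod (𝓡 1)).prod 𝓘(ℝ, Unit)) ((𝓡 1).prod (𝓡 1)) ∞
        fun p : (Circle × Circle) × Multiplicative ℤ => p.1 := contMDiff_fst
    have hk : Continuous fun p : (Circle × Circle) × Multiplicative ℤ => p.2⁻¹ :=
      continuous_snd.inv
    -- The inverse of `(z, k)` is `(σ^(-k) (z⁻¹), -k)`.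
    have h := (((hz.fst.inv.zpow_discrete (hcont hk 0 0)).mul
      (hz.snd.inv.zpow_discrete (hcont hk 0 1))).prodMk
      ((hz.fst.inv.zpow_discrete (hcont hk 1 0)).mul
      (hz.snd.inv.zpow_discrete (hcont hk 1 1)))).prodMk
      (contMDiff_of_eventually_const (I' := 𝓘(ℝ, Unit)) hk)
    refine h.congr fun p => ?_
    simp [e, ToralGroup.homeomorphProd, hm, -map_inv]

/-- Needed for continuity of the action on the coset space. -/
theorem ToralGroup.isTopologicalGroup : IsTopologicalGroup (ToralGroup σ) := by
  obtain ⟨-, -, E, _, _, H, _, I, _, -, -, -, h⟩ := ToralGroup.isLieGroupOfDim_two σ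
  exact topologicalGroup_of_lieGroup I ∞

theorem ToralGroup.continuous_left : Continuous fun g : ToralGroup σ => g.left :=
  continuous_fst.comp (continuous_induced_dom (f := fun g : ToralGroup σ => (g.left, g.right)))

theorem ToralGroup.continuous_inl :
    Continuous (SemidirectProduct.inl : Torus2 →* ToralGroup σ) :=
  continuous_induced_rng.2 (Continuous.prodMk continuous_id continuous_const)

theorem ToralGroup.discreteTopology_intSubgroup :
    DiscreteTopology (ToralGroup.intSubgroup σ) := by
  have hr : Continuous fun g : ToralGroup.intSubgroup σ => (g : ToralGroup σ).right :=
    (continuous_snd.comp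
      (continuous_induced_dom (f := fun g : ToralGroup σ => (g.left, g.right)))).comp
      continuous_subtype_val
  refine DiscreteTopology.of_continuous_injective hr ?_
  rintro ⟨_, k, rfl⟩ ⟨_, l, rfl⟩ h
  simp only [SemidirectProduct.right_inr] at h
  rw [h]

/-- The coset space `(𝕋² ⋊ ℤ) / ℤ` is homeomorphic to the torus. -/
noncomputable def ToralGroup.homeomorphQuotient :
    Torus2 ≃ₜ ToralGroup σ ⧸ ToralGroup.intSubgroup σ where
  toFun z := ((SemidirectProduct.inl z : ToralGroup σ) : ToralGroup σ ⧸ ToralGroup.intSubgroup σ)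
  -- Right multiplication by `inr k` does not change the left component.
  invFun := Quotient.lift (fun g : ToralGroup σ => g.left) (by
    intro a b hab
    obtain ⟨k, hk⟩ := QuotientGroup.leftRel_apply.1 hab
    have : b = a * SemidirectProduct.inr k := by rw [hk, mul_inv_cancel_left]
    simp [this])
  left_inv z := rfl
  right_inv x := by
    induction x using QuotientGroup.induction_on with
    | H g =>
      refine QuotientGroup.eq.2 ⟨g.right, ?_⟩
      change _ = (SemidirectProduct.inl g.left)⁻¹ * g
      rw [eq_inv_mul_iff_mul_eq, SemidirectProduct.inl_left_mul_inr_right]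
  continuous_toFun := continuous_quotient_mk'.comp (ToralGroup.continuous_inl σ)
  continuous_invFun := (ToralGroup.continuous_left σ).quotient_lift _

/-- The defining relation `inr k * inl z = inl (σ^k z) * inr k`: the two representatives differ by
an element of `H`. -/
theorem ToralGroup.inr_smul_homeomorphQuotient (k : Multiplicative ℤ) (z : Torus2) :
    (SemidirectProduct.inr k : ToralGroup σ) • ToralGroup.homeomorphQuotient σ z =
      ToralGroup.homeomorphQuotient σ (iterateHom σ k z) := by
  refine QuotientGroup.eq.2 ⟨k⁻¹, ?_⟩
  ext <;> simp

theorem iterateHom_ofAdd_natCast (n : ℕ) (z : Torus2) :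
    iterateHom σ (Multiplicative.ofAdd (n : ℤ)) z = σ^[n] z := by
  have h : iterateHom σ (Multiplicative.ofAdd (n : ℤ)) = σ.toMulEquiv ^ n := by
    simp [iterateHom, zpowersHom_apply]
  rw [h]
  induction n generalizing z with
  | zero => rfl
  | succ n ih =>
    rw [pow_succ, MulAut.mul_apply, Function.iterate_succ_apply]
    exact ih _ (by simp [iterateHom, zpowersHom_apply])

theorem ToralGroup.isTopologicalManifoldOfDim_two :
    IsTopologicalManifoldOfDim 2 (ToralGroup σ ⧸ ToralGroup.intSubgroup σ) := by
  let e := ToralGroup.homeomorphQuotient σ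
  refine ⟨e.t2Space, e.symm.secondCountableTopology, ⟨?_⟩⟩
  -- The product charts take values in a product of two lines, identified here with the plane.
  let c : ModelPi (fun _ : Fin 2 => EuclideanSpace ℝ (Fin 1)) ≃ₜ EuclideanSpace ℝ (Fin 2) :=
    (Homeomorph.piCongrRight fun _ : Fin 2 =>
      ((PiLp.homeomorph 2 fun _ : Fin 1 => ℝ).trans (Homeomorph.funUnique (Fin 1) ℝ))).trans
      (PiLp.homeomorph 2 fun _ : Fin 2 => ℝ).symm
  let _ : ChartedSpace (EuclideanSpace ℝ (Fin 2))
      (ModelPi fun _ : Fin 2 => EuclideanSpace ℝ (Fin 1)) :=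
    c.isOpenEmbedding.singletonChartedSpace
  let _ : ChartedSpace (EuclideanSpace ℝ (Fin 2)) Torus2 :=
    ChartedSpace.comp _ (ModelPi fun _ : Fin 2 => EuclideanSpace ℝ (Fin 1)) _
  exact e.symm.pullbackChartedSpace _

end ToralGroup

/-! ### Existence of a hyperbolic automorphism. -/

section CatMap

/-- The automorphism of the torus induced by the matrix `!![2, 1; 1, 1]`. -/
noncomputable def Torus2.catMap : Torus2 ≃ₜ* Torus2 where
  toFun z := ![z 0 ^ 2 * z 1, z 0 * z 1]
  invFun z := ![z 0 * (z 1)⁻¹, (z 0)⁻¹ * z 1 ^ 2]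
  left_inv z := by
    ext1 i
    fin_cases i
    · simp [pow_two, mul_assoc, mul_comm, mul_left_comm]
    · simp [pow_two, mul_assoc, mul_comm, mul_left_comm]
  right_inv z := by
    ext1 i
    fin_cases i
    · simp [pow_two, mul_assoc, mul_comm, mul_left_comm]
    · simp [pow_two, mul_assoc, mul_comm, mul_left_comm]
  map_mul' z w := by
    ext1 i
    fin_cases i
    · simp [pow_two, mul_assoc, mul_comm, mul_left_comm]
    · simp [mul_assoc, mul_left_comm]
  continuous_toFun := by
    refine continuous_pi fun i => ?_
    fin_cases i
    · change Continuous fun z : Torus2 => z 0 ^ 2 * z 1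
      fun_prop
    · change Continuous fun z : Torus2 => z 0 * z 1
      fun_prop
  continuous_invFun := by
    refine continuous_pi fun i => ?_
    fin_cases i
    · change Continuous fun z : Torus2 => z 0 * (z 1)⁻¹
      fun_prop
    · change Continuous fun z : Torus2 => (z 0)⁻¹ * z 1 ^ 2
      fun_prop

theorem Torus2.isHyperbolicAut_catMap : IsHyperbolicAut Torus2.catMap := by
  refine ⟨!![2, 1; 1, 1], fun z i => ?_, fun μ hμ h1 => ?_⟩
  · fin_cases i
    · simp only [Fin.prod_univ_two]
      change z 0 ^ 2 * z 1 = z 0 ^ (2 : ℤ) * z 1 ^ (1 : ℤ)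
      rw [zpow_one]
      rfl
    · simp only [Fin.prod_univ_two]
      change z 0 * z 1 = z 0 ^ (1 : ℤ) * z 1 ^ (1 : ℤ)
      rw [zpow_one, zpow_one]
  · obtain ⟨v, hv⟩ := hμ.exists_hasEigenvector
    have hv0 := hv.2
    have happ := hv.apply_eq_smul
    rw [Matrix.toLin'_apply] at happ
    have e0 : 2 * v 0 + v 1 = μ * v 0 := by
      simpa [Matrix.mulVec, dotProduct, Fin.sum_univ_two] using congrFun happ 0
    have e1 : v 0 + v 1 = μ * v 1 := by
      simpa [Matrix.mulVec, dotProduct, Fin.sum_univ_two] using congrFun happ 1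
    have hne : v 1 ≠ 0 := fun h => hv0 (by
      funext i
      fin_cases i
      · simpa [h] using e1
      · exact h)
    -- The characteristic equation; for `‖μ‖ = 1` the triangle inequality would give `3 ≤ 2`.
    have hpoly : 3 * μ = μ ^ 2 + 1 := by
      apply mul_right_cancel₀ hne
      have : v 0 = μ * v 1 - v 1 := by rw [← e1]; ring
      rw [this] at e0
      linear_combination e0
    have h3 : ‖3 * μ‖ = 3 := by rw [norm_mul, h1]; norm_num
    have h4 := norm_add_le (μ ^ 2) 1
    rw [← hpoly, h3, norm_pow, h1] at h4
    norm_num at h4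

end CatMap

/-! ### Non-representability and the final assembly. -/

theorem IsHyperbolicAut.not_isRosenthalRepresentable {σ : Torus2 ≃ₜ* Torus2}
    (hσ : IsHyperbolicAut σ) :
    ¬ IsRosenthalRepresentable.{u} (ToralGroup σ) (ToralGroup σ ⧸ ToralGroup.intSubgroup σ) := by
  rintro ⟨V, _, _, _, hV, ρ, hρ⟩
  obtain ⟨C, hC⟩ := ρ.bounded_α
  let e := ToralGroup.homeomorphQuotient σ
  let t : ℕ → ToralGroup σ := fun n => SemidirectProduct.inr (Multiplicative.ofAdd (n : ℤ))
  -- Two distinct points, which the injective `α` sends to distinct functionals; on a trivial torus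
  -- all monomials would be trivial.
  obtain ⟨z, hz⟩ : ∃ z : Torus2, z ≠ 1 := by
    by_contra! h
    have h0 := (Torus2.monomial_eq_one_iff (Pi.single 0 1)).1 (by
      ext1 z
      rw [h z, map_one, map_one])
    simpa using congrFun h0 0
  refine not_isRosenthalSpace_of_mixing (fun n => σ^[n])
    (fun n => σ.continuous_toFun.iterate n) hσ.mixing
    (fun z => WeakDual.toStrongDual (ρ.α (e z)))
    (fun v => (WeakDual.eval_continuous v).comp (ρ.continuous_α.comp e.continuous)) C
    (fun z => hC _) (fun n v => (ρ.h (t n))⁻¹ v) (fun n v => LinearIsometryEquiv.norm_map _ v)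
    (fun n x v => ?_) z 1 (fun h => hz ?_) hV
  · change ρ.α (e (σ^[n] x)) v = ρ.α (e x) ((ρ.h (t n))⁻¹ v)
    rw [← ρ.equivariant_α, ToralGroup.inr_smul_homeomorphQuotient, iterateHom_ofAdd_natCast]
  · exact e.injective (hρ.injective (WeakDual.toStrongDual.injective h))

theorem corollary4p1 :
    (∃ σ : Torus2 ≃ₜ* Torus2, IsHyperbolicAut σ) ∧
    ∀ σ : Torus2 ≃ₜ* Torus2, IsHyperbolicAut σ →
      IsLieGroupOfDim 2 (ToralGroup σ) ∧
      DiscreteTopology (ToralGroup.intSubgroup σ) ∧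
      CompactSpace (ToralGroup σ ⧸ ToralGroup.intSubgroup σ) ∧
      IsTopologicalManifoldOfDim 2 (ToralGroup σ ⧸ ToralGroup.intSubgroup σ) ∧
      ContinuousSMul (ToralGroup σ) (ToralGroup σ ⧸ ToralGroup.intSubgroup σ) ∧
      ¬ IsRosenthalRepresentable.{u} (ToralGroup σ)
          (ToralGroup σ ⧸ ToralGroup.intSubgroup σ) := by
  refine ⟨⟨Torus2.catMap, Torus2.isHyperbolicAut_catMap⟩, fun σ hσ => ?_⟩
  have := ToralGroup.isTopologicalGroup σ
  exact ⟨ToralGroup.isLieGroupOfDim_two σ, ToralGroup.discreteTopology_intSubgroup σ,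
    (ToralGroup.homeomorphQuotient σ).compactSpace, ToralGroup.isTopologicalManifoldOfDim_two σ,
    inferInstance, hσ.not_isRosenthalRepresentable⟩
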